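/- An inversion sequence of length $n$ is an integer sequence $e=(e_1,\dots,e_n)$ with $0\le e_j\le j-1$ for all $j$. The reduction of a finite word of integers is obtained by replacing every occurrence of its $i$-th smallest distinct value by $i-1$; $e$ avoids a pattern $w$ of length $k$ if there are no indices $i_1<\dots<i_k$ such that the reduction of $e_{i_1}\cdots e_{i_k}$ is $w$. Let $\mathcal{IS}_n^{(m)}(102,000)$ be the set of inversion sequences of length $n$ that avoid both $102$ and $000$ and have exactly $m$ distinct entries, i.e. $|\{e_1,\dots,e_n\}|=m$. There is a unique formal power series $B=B(x,y)\in\mathbb{Q}[[x,y]]$ with $$B=1+xyB^2\bigl(xB^2-(x-1)(B-1)\bigr).$$ Its coefficients $b_n^{(m)}:=[x^ny^m]B(x,y)$, $n,m\ge 0$, are given by $b_0^{(m)}=\delta_{0,m}$ for $m\ge 0$, by $b_n^{(0)}=0$ for $n\ge1$, and by $$b_n^{(m)}=\frac1m\binom{m}{n-m}\sum_{j=0}^{n-m}\binom{n-m}{j}\binom{n+m-j}{2m+j+1}\qquad(n,m\ge1),$$ which is read as $0$ when $n<m$. For all integers $n,m\ge1$, $$\left|\mathcal{IS}_n^{(m)}(102,000)\right|=b_{n+1}^{(m)}+\sum_{k=1}^{n}\sum_{\ell=0}^{m}b_k^{(\ell)}\,b_{n-k}^{(m-\ell)}.$$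 -/

import Mathlib

open scoped PowerSeries

namespace InvSeq

/-- The inversion sequences `(e_1, …, e_n)` of length `n`, those with `0 ≤ e_j ≤ j - 1`; the entry
`e_j` is the value at the index `j - 1` of `Fin n`. -/
def inversionSequences (n : ℕ) : Finset (Fin n → ℕ) :=
  Fintype.piFinset fun j : Fin n => Finset.range (j.val + 1)

/-- The reduction of a word: every entry equal to the `i`-th smallest value occurring in the word
is replaced with `i - 1`, the number of distinct smaller values that occur. -/
def reduction {k : ℕ} (w : Fin k → ℕ) : Fin k → ℕ :=
  fun i => ((Finset.univ.image w).filter (· < w i)).card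

/-- The sequence `e` contains the pattern `w`: some subsequence of `e` has reduction `w`. -/
def Contains {n k : ℕ} (e : Fin n → ℕ) (w : Fin k → ℕ) : Prop :=
  ∃ f : Fin k → Fin n, StrictMono f ∧ reduction (e ∘ f) = w

/-- The sequence `e` avoids the pattern `w`. -/
def Avoids {n k : ℕ} (e : Fin n → ℕ) (w : Fin k → ℕ) : Prop :=
  ¬ Contains e w

/-- The number of distinct elements of a sequence. -/
def dist {n : ℕ} (e : Fin n → ℕ) : ℕ :=
  (Finset.univ.image e).card

open Classical in
/-- The `(102, 000)`-avoiding inversion sequences of length `n` with `m` distinct elements. -/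
noncomputable def IS (n m : ℕ) : Finset (Fin n → ℕ) :=
  (inversionSequences n).filter fun e =>
    Avoids e ![1, 0, 2] ∧ Avoids e ![0, 0, 0] ∧ dist e = m

/-- The closed form of `b_n^{(m)}`. Here `b_0^{(0)} = 1`, the value is `0` for `n ≥ 1`, `m = 0`, and
a binomial coefficient `m.choose (n - m)` with `n < m` is `0`. In the last case all
natural-number subtractions are exact. -/
def b (n m : ℕ) : ℚ :=
  if m = 0 then (if n = 0 then 1 else 0)
  else if n < m then 0
  else (1 / (m : ℚ)) * (m.choose (n - m) : ℚ) *
    ∑ j ∈ Finset.range (n - m + 1),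
      ((n - m).choose j : ℚ) * ((n + m - j).choose (2 * m + j + 1) : ℚ)

/-- The variable `x` of the ring `ℚ⟦x⟧⟦y⟧` of formal power series in `x` and `y`. -/
noncomputable def x : ℚ⟦X⟧⟦X⟧ := PowerSeries.C (PowerSeries.X : ℚ⟦X⟧)

/-- The variable `y` of the ring `ℚ⟦x⟧⟦y⟧` of formal power series in `x` and `y`. -/
noncomputable def y : ℚ⟦X⟧⟦X⟧ := PowerSeries.X

/-- The coefficient of `x ^ n * y ^ m` in a formal power series in `x` and `y`. -/
noncomputable def coeffXY (n m : ℕ) (F : ℚ⟦X⟧⟦X⟧) : ℚ :=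
  PowerSeries.coeff n (PowerSeries.coeff m F)

/-- The equation `B = 1 + x y B² (x B² - (x - 1) (B - 1))`. -/
def FunctionalEquation (B : ℚ⟦X⟧⟦X⟧) : Prop :=
  B = 1 + x * y * B ^ 2 * (x * B ^ 2 - (x - 1) * (B - 1))

end InvSeq

open scoped PowerSeries

namespace InvSeq

/-! In terms of `A = B - 1` the functional equation reads `A = y φ(A)`, with `φ` a polynomial over
`ℚ⟦x⟧`. Iteration converges `y`-adically to a solution, and Lagrange inversion
(`coeff_eval₂_of_eq_X_mul_eval₂`) forces every coefficient to be `b n m`, which also gives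
uniqueness.

For the count, build each avoider by inserting the values 0, 1, 2, … in turn, each at most twice. A
copy of the new maximum `v` completes a 102 exactly when the smaller entries before it contain a
descent, and the inversion condition requires its position to be at least `v`. So `v` may enter only
the slots from `v` to the length of the initial weakly increasing run (`mem_children_iff`), and the
future depends only on the number `s` of these slots. The resulting series `F_s = stateSeries s`
satisfy a linear recurrence with `F_0 = 1`, and `F_1` counts all avoiders (`sum_goodWords`,
`card_IS`).

Multiplying the recurrence by `T ^ s` and summing gives one equation for `E = ∑ F_{s+1} T ^ s` and
`F_1`. At `T = (B - 1) / B` the coefficient of `E` vanishes by the functional equation, which leaves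
`x F_1 = x B² - (x - 1)(B - 1)` (`x_mul_stateSeries_one`). Comparing coefficients finishes the
proof. -/

/-! ### Fixed points in power series and Lagrange inversion -/

open Polynomial in
/-- The fixed point equation `A = X * φ(A)` has a solution in formal power series. -/
theorem exists_eq_X_mul_eval₂ {R : Type*} [CommRing R] (φ : R[X]) :
    ∃ A : R⟦X⟧, A = PowerSeries.X * φ.eval₂ PowerSeries.C A := by
  have hsub (N : ℕ) (a b : R⟦X⟧) (h : PowerSeries.X ^ N ∣ a - b) :
      PowerSeries.X ^ (N + 1) ∣ PowerSeries.X * φ.eval₂ PowerSeries.C a - PowerSeries.X * φ.eval₂ PowerSeries.C b := by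
    rw [← mul_sub, pow_succ']
    refine mul_dvd_mul_left _ (h.trans ?_)
    rw [← eval_map, ← eval_map]
    exact sub_dvd_eval_sub a b _
  let a : ℕ → R⟦X⟧ := fun k => (fun f : R⟦X⟧ => PowerSeries.X * φ.eval₂ PowerSeries.C f)^[k] 0
  have ha (k : ℕ) : a (k + 1) = PowerSeries.X * φ.eval₂ PowerSeries.C (a k) :=
    Function.iterate_succ_apply' _ _ _
  have hstep (k : ℕ) : PowerSeries.X ^ k ∣ a (k + 1) - a k := by
    induction k with
    | zero => simp
    | succ k ih =>
      rw [ha (k + 1), ha k]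
      exact hsub k _ _ (by rwa [← ha k])
  have hle (k d : ℕ) : PowerSeries.X ^ k ∣ a (k + d) - a k := by
    induction d with
    | zero => simp
    | succ d ih =>
      have := (pow_dvd_pow PowerSeries.X (Nat.le_add_right k d)).trans (hstep (k + d))
      simpa [add_assoc] using dvd_add this ih
  -- The limit of the iterates: by `hle`, the coefficient of `X ^ m` is stable from the iterate `m +
  -- 1` on.
  let A : R⟦X⟧ := PowerSeries.mk fun m => PowerSeries.coeff m (a (m + 1))
  have hA (N : ℕ) : PowerSeries.X ^ N ∣ A - a N := by
    rw [PowerSeries.X_pow_dvd_iff]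
    intro m hm
    obtain ⟨d, rfl⟩ := Nat.exists_eq_add_of_le (Nat.succ_le_of_lt hm)
    have h := PowerSeries.X_pow_dvd_iff.1 (hle (m + 1) d) m (Nat.lt_succ_self m)
    simp only [map_sub] at h ⊢
    simp only [A, PowerSeries.coeff_mk]
    rw [← neg_eq_zero, neg_sub]
    exact h
  refine ⟨A, ?_⟩
  rw [← sub_eq_zero]
  ext m
  have h1 := hA (m + 1)
  have h2 := hsub m _ _ (hA m)
  rw [← ha] at h2
  have h3 := dvd_sub h1 h2
  rw [sub_sub_sub_cancel_right] at h3
  simpa using PowerSeries.X_pow_dvd_iff.1 h3 m (Nat.lt_succ_self m)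

open Polynomial in
/-- Lagrange inversion: if `A = X * φ(A)`, then the coefficients of `g(A)` are given by those of
`g' * φ ^ M`. -/
theorem coeff_eval₂_of_eq_X_mul_eval₂ {R : Type*} [CommRing R] [IsDomain R] [CharZero R]
    (φ : R[X]) (A : R⟦X⟧) (hA : A = PowerSeries.X * φ.eval₂ PowerSeries.C A) (M : ℕ) (g : R[X]) :
    (M : R) * PowerSeries.coeff M (g.eval₂ PowerSeries.C A) = (X * derivative g * φ ^ M).coeff M := by
  have hA0 : PowerSeries.constantCoeff A = 0 := by rw [hA]; simp
  induction M generalizing g with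
  | zero => simp
  | succ M ih =>
    induction g using Polynomial.induction_on' with
    | add p q hp hq => simp only [eval₂_add, map_add, mul_add, add_mul, coeff_add, hp, hq]
    | monomial k r =>
      rw [← C_mul_X_pow_eq_monomial]
      suffices h : ((M + 1 : ℕ) : R) * PowerSeries.coeff (M + 1) (A ^ k) =
          (X * derivative (X ^ k : R[X]) * φ ^ (M + 1)).coeff (M + 1) by
        rw [derivative_C_mul]
        rw [show X * (C r * derivative (X ^ k : R[X])) * φ ^ (M + 1) =
          C r * (X * derivative (X ^ k : R[X]) * φ ^ (M + 1)) by ring, coeff_C_mul, ← h]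
        rw [eval₂_mul, eval₂_C, eval₂_X_pow, PowerSeries.coeff_C_mul]
        ring
      rcases k with _ | k
      · simp
      -- Replacing one factor `A` by `X * φ(A)` lowers the degree to `M`, where induction applies
      -- with `X ^ k * φ` in place of `g`.
      have hpow : A ^ (k + 1) = PowerSeries.X * (X ^ k * φ).eval₂ PowerSeries.C A := by
        rw [pow_succ]
        nth_rewrite 2 [hA]
        rw [eval₂_mul, eval₂_X_pow]
        ring
      rw [hpow, PowerSeries.coeff_succ_X_mul]
      set c := (X ^ k * φ ^ (M + 1)).coeff M with hc
      have hr : (X * derivative (X ^ (k + 1) : R[X]) * φ ^ (M + 1)).coeff (M + 1) =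
          (k + 1 : R) * c := by
        rw [derivative_X_pow, show X * (C ((k + 1 : ℕ) : R) * X ^ (k + 1 - 1)) * φ ^ (M + 1) =
          C ((k + 1 : ℕ) : R) * ((X ^ k * φ ^ (M + 1)) * X) by simp; ring, coeff_C_mul, coeff_mul_X]
        simp [hc]
      rw [hr]
      rcases Nat.eq_zero_or_pos M with rfl | hM
      · rcases k with _ | k
        · have : PowerSeries.constantCoeff (φ.eval₂ PowerSeries.C A) = φ.coeff 0 := by
            rw [Polynomial.eval₂_eq_sum_range, map_sum]
            rw [Finset.sum_eq_single_of_mem 0 (by simp)]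
            · simp
            · intro i _ hi
              simp [hA0, hi]
          simp [hc, this]
        · simp [hc, hA0, coeff_zero_eq_eval_zero, eval₂_mul]
      · have hM0 : (M : R) ≠ 0 := by exact_mod_cast hM.ne'
        apply mul_left_cancel₀ hM0
        have h1 := ih (X ^ k * φ)
        -- This absorbs `φ'` into a total derivative; since `X * p'` has `M`-th coefficient `M *
        -- p.coeff M`, the right side contributes `M * k * c + M * c`.
        have h2 : ((M + 1 : ℕ) : R[X]) * (X * derivative (X ^ k * φ) * φ ^ M) =
            ((M : R[X]) * (X * derivative (X ^ k)) * φ ^ (M + 1)) +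
              X * derivative (X ^ k * φ ^ (M + 1)) := by
          simp only [derivative_mul, derivative_pow_succ]
          push_cast
          simp only [map_add, map_natCast, map_one]
          ring
        have h3 : X * derivative (X ^ k : R[X]) = (k : R[X]) * X ^ k := by
          rcases k with _ | k
          · simp
          · rw [derivative_X_pow]; simp; ring
        have h4 (p : R[X]) : (X * derivative p).coeff M = M * p.coeff M := by
          rcases M with _ | M
          · simp
          · rw [coeff_X_mul, coeff_derivative]; push_cast; ring
        have h5 := congrArg (fun p : R[X] => p.coeff M) h2
        simp only [h3, coeff_add, h4] at h5
        rw [show (M : R[X]) * ((k : R[X]) * X ^ k) * φ ^ (M + 1) =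
          ((M * k : ℕ) : R[X]) * (X ^ k * φ ^ (M + 1)) by push_cast; ring] at h5
        simp only [coeff_natCast_mul, ← hc] at h5
        rw [← h1] at h5
        push_cast at h5 ⊢
        linear_combination h5

/-! ### The functional equation and its coefficients -/

/-- The polynomial `φ = x (1 + u)² (x (1 + u)² - (x - 1) u)` in `u`, for which the functional
equation reads `B - 1 = y φ(B - 1)`. -/
noncomputable def phi : Polynomial ℚ⟦X⟧ :=
  Polynomial.C PowerSeries.X * (1 + Polynomial.X) ^ 2 *
    (Polynomial.C PowerSeries.X * (1 + Polynomial.X) ^ 2 -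
      (Polynomial.C PowerSeries.X - 1) * Polynomial.X)

theorem functionalEquation_iff (B : ℚ⟦X⟧⟦X⟧) :
    FunctionalEquation B ↔ B - 1 = PowerSeries.X * phi.eval₂ PowerSeries.C (B - 1) := by
  have h : PowerSeries.X * phi.eval₂ PowerSeries.C (B - 1) =
      x * y * B ^ 2 * (x * B ^ 2 - (x - 1) * (B - 1)) := by
    simp only [phi, Polynomial.eval₂_mul, Polynomial.eval₂_sub, Polynomial.eval₂_add,
      Polynomial.eval₂_pow, Polynomial.eval₂_one, Polynomial.eval₂_C, Polynomial.eval₂_X, x, y]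
    ring
  rw [h, FunctionalEquation, sub_eq_iff_eq_add']

theorem exists_functionalEquation : ∃ B, FunctionalEquation B := by
  obtain ⟨A, hA⟩ := exists_eq_X_mul_eval₂ phi
  exact ⟨1 + A, by rw [functionalEquation_iff, add_sub_cancel_left]; exact hA⟩

open Polynomial in
theorem coeff_X_mul_one_add_X_pow_mul_pow (m i : ℕ) :
    (X * (1 + X) ^ (2 * m) * ((1 + X) + X ^ 2) ^ i : ℚ[X]).coeff i =
      ∑ j ∈ Finset.range (i + 1),
        (i.choose j : ℚ) * ((2 * m + i - j).choose (2 * m + j + 1) : ℚ) := by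
  rw [add_comm (1 + X : ℚ[X]) (X ^ 2), add_pow (X ^ 2), Finset.mul_sum, finsetSum_coeff]
  refine Finset.sum_congr rfl fun j hj => ?_
  have hj : j ≤ i := Nat.lt_succ_iff.1 (Finset.mem_range.1 hj)
  rw [show (X * (1 + X) ^ (2 * m) * ((X ^ 2) ^ j * (1 + X) ^ (i - j) * (i.choose j : ℚ[X])) : ℚ[X])
    = (i.choose j : ℚ[X]) * ((1 + X) ^ (2 * m + i - j) * X ^ (2 * j + 1)) by
      rw [show 2 * m + i - j = 2 * m + (i - j) by omega]; ring]
  rw [coeff_natCast_mul, coeff_mul_X_pow']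
  congr 1
  split_ifs with h
  · rw [coeff_one_add_X_pow]
    congr 1
    apply Nat.choose_symm_of_eq_add
    omega
  · rw [Nat.choose_eq_zero_of_lt (by omega), Nat.cast_zero]

-- Since `φ = x (1 + u)² (x (1 + u + u²) + u)`, choosing the first summand in `i` of the `m` last
-- factors produces `x ^ (m + i)`; only `i = n - m` contributes.
open Polynomial in
theorem coeff_coeff_X_mul_phi_pow (n m : ℕ) :
    PowerSeries.coeff n ((X * phi ^ m).coeff m) =
      if n < m then 0 else (m.choose (n - m) : ℚ) *
        ∑ j ∈ Finset.range (n - m + 1),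
          ((n - m).choose j : ℚ) * ((n + m - j).choose (2 * m + j + 1) : ℚ) := by
  have hphi : (X * phi ^ m : (ℚ⟦X⟧)[X]) = ∑ i ∈ Finset.range (m + 1),
      C ((PowerSeries.X : ℚ⟦X⟧) ^ (m + i)) * ((m.choose i : (ℚ⟦X⟧)[X]) * (X ^ (m - i) *
        (X * (1 + X) ^ (2 * m) * ((1 + X) + X ^ 2) ^ i : ℚ[X]).map (PowerSeries.C))) := by
    rw [show phi = C PowerSeries.X * (1 + X) ^ 2 *
      (C PowerSeries.X * ((1 + X) + X ^ 2) + X) by rw [phi]; ring, mul_pow, add_pow (C PowerSeries.X * _),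
      Finset.mul_sum, Finset.mul_sum]
    refine Finset.sum_congr rfl fun i _ => ?_
    simp only [Polynomial.map_mul, Polynomial.map_pow, Polynomial.map_add, Polynomial.map_X,
      Polynomial.map_one, C_mul, C_pow, pow_add, mul_pow, pow_mul]
    ring
  have hcoeff (i : ℕ) (hi : i ∈ Finset.range (m + 1)) :
      PowerSeries.coeff n ((C ((PowerSeries.X : ℚ⟦X⟧) ^ (m + i)) *
        ((m.choose i : (ℚ⟦X⟧)[X]) * (X ^ (m - i) * (X * (1 + X) ^ (2 * m) *
          ((1 + X) + X ^ 2) ^ i : ℚ[X]).map (PowerSeries.C)))).coeff m) =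
      if n = m + i then (m.choose i : ℚ) *
        (X * (1 + X) ^ (2 * m) * ((1 + X) + X ^ 2) ^ i : ℚ[X]).coeff i else 0 := by
    have hi : i ≤ m := Nat.lt_succ_iff.1 (Finset.mem_range.1 hi)
    rw [coeff_C_mul, coeff_natCast_mul, coeff_X_pow_mul', if_pos (Nat.sub_le _ _),
      Nat.sub_sub_self hi, coeff_map, ← map_natCast (PowerSeries.C (R := ℚ)), ← map_mul, mul_comm,
      PowerSeries.coeff_C_mul, PowerSeries.coeff_X_pow, mul_ite, mul_one, mul_zero]
  rw [hphi, finsetSum_coeff, map_sum, Finset.sum_congr rfl hcoeff]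
  split_ifs with h
  · exact Finset.sum_eq_zero fun i _ => if_neg (by omega)
  · obtain ⟨d, rfl⟩ := Nat.exists_eq_add_of_le (not_lt.1 h)
    rw [Nat.add_sub_cancel_left]
    simp only [Nat.add_left_cancel_iff, Finset.sum_ite_eq, Finset.mem_range]
    split_ifs with hd
    · rw [coeff_X_mul_one_add_X_pow_mul_pow, show m + d + m = 2 * m + d by ring]
    · rw [Nat.choose_eq_zero_of_lt (by omega)]; simp

theorem coeffXY_of_functionalEquation {B : ℚ⟦X⟧⟦X⟧} (hB : FunctionalEquation B) (n m : ℕ) :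
    coeffXY n m B = b n m := by
  have hA := (functionalEquation_iff B).1 hB
  have hBA : B = (B - 1) + 1 := by ring
  rcases Nat.eq_zero_or_pos m with rfl | hm
  · have h0 : PowerSeries.coeff 0 (B - 1) = 0 := by rw [hA]; simp
    rw [coeffXY, hBA, map_add, h0]
    simp [b, PowerSeries.coeff_one]
  · have : CharZero ℚ⟦X⟧ := charZero_of_injective_ringHom (PowerSeries.C_injective (R := ℚ))
    have h := coeff_eval₂_of_eq_X_mul_eval₂ phi _ hA m Polynomial.X
    rw [Polynomial.eval₂_X, Polynomial.derivative_X, mul_one] at h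
    have h' := congrArg (PowerSeries.coeff n) h
    rw [coeff_coeff_X_mul_phi_pow, ← map_natCast (PowerSeries.C (R := ℚ)),
      PowerSeries.coeff_C_mul] at h'
    have hm0 : (m : ℚ) ≠ 0 := by exact_mod_cast hm.ne'
    have hc : coeffXY n m B = PowerSeries.coeff n (PowerSeries.coeff m (B - 1)) := by
      rw [coeffXY, map_sub, PowerSeries.coeff_one, if_neg hm.ne', sub_zero]
    rw [hc, b, if_neg hm.ne']
    apply mul_left_cancel₀ hm0
    rw [h']
    split_ifs
    · simp
    · field_simp

theorem existsUnique_functionalEquation : ∃! B : ℚ⟦X⟧⟦X⟧, FunctionalEquation B := by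
  obtain ⟨B, hB⟩ := exists_functionalEquation
  refine ⟨B, hB, fun B' hB' => ?_⟩
  ext m n
  exact (coeffXY_of_functionalEquation hB' n m).trans (coeffXY_of_functionalEquation hB n m).symm

/-! ### The recurrence in the number of slots -/

/-- The contribution to `stateCoeff (m + 1) (t + 1)` of the choices that insert at least one copy of
the current value, when the series for `m` are given by `f`. -/
noncomputable def insertionSeries {R : Type*} [CommRing R] (z : R) (f : ℕ → R) (t : ℕ) : R :=
  z * ∑ r ∈ Finset.range (t + 1), f (r + 1) +
    z ^ 2 * (∑ r ∈ Finset.range (t + 1), f (r + 2) +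
      ∑ r ∈ Finset.range (t + 1), ((t - r : ℕ) : R) * f (r + 1))

/-- The coefficient of `y ^ m` in `stateSeries s`. -/
noncomputable def stateCoeff : ℕ → ℕ → ℚ⟦X⟧
  | 0 => fun _ => 1
  | m + 1 => fun s => ∑ t ∈ Finset.range s, insertionSeries PowerSeries.X (stateCoeff m) t

/-- The generating function, by length and number of distinct entries, of the ways to complete a
word by inserting larger and larger values, when the current value has `s` admissible slots. -/
noncomputable def stateSeries (s : ℕ) : ℚ⟦X⟧⟦X⟧ := PowerSeries.mk fun m => stateCoeff m s

theorem stateSeries_zero : stateSeries 0 = 1 := by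
  ext m : 1
  rcases m with _ | m <;> simp [stateSeries, stateCoeff, PowerSeries.coeff_one]

/-- With `s + 1` slots, skipping the current value loses one slot, and inserting it costs `y`. A
single copy in slot `r` leaves `r + 1` slots, two copies both in slot `r` leave `r + 2`, and a
second copy in one of the `s - r` later slots leaves `r + 1`. -/
theorem stateSeries_succ (s : ℕ) :
    stateSeries (s + 1) = stateSeries s + y * insertionSeries x stateSeries s := by
  ext m : 1
  rcases m with _ | m
  · simp [stateSeries, stateCoeff, y]
  · rw [map_add, y, PowerSeries.coeff_succ_X_mul]
    have hc (m s : ℕ) : PowerSeries.coeff m (stateSeries s) = stateCoeff m s :=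
      PowerSeries.coeff_mk _ _
    have hn (k s : ℕ) : PowerSeries.coeff m ((k : ℚ⟦X⟧⟦X⟧) * stateSeries s) =
        (k : ℚ⟦X⟧) * stateCoeff m s := by
      rw [← map_natCast (PowerSeries.C (R := ℚ⟦X⟧)), PowerSeries.coeff_C_mul, hc]
    simp only [insertionSeries, x, map_add, ← map_pow, PowerSeries.coeff_C_mul, map_sum, hc, hn]
    exact Finset.sum_range_succ _ s

/-! ### Generating functions in `T` and the kernel method -/

/-- The series `∑ g s * T ^ s`, for `T` with vanishing constant coefficient. -/
noncomputable def evalSeq {R : Type*} [CommRing R] (T : R⟦X⟧) (g : ℕ → R⟦X⟧) : R⟦X⟧ :=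
  PowerSeries.mk fun m => PowerSeries.coeff m (∑ s ∈ Finset.range (m + 1), g s * T ^ s)

section evalSeq

variable {R : Type*} [CommRing R] {T : R⟦X⟧}

/-- As `X ^ s ∣ T ^ s`, terms with `s ≥ N` do not matter modulo `X ^ N`. This reduces identities for
`evalSeq` to finite sums. -/
theorem X_pow_dvd_evalSeq_sub (hT : PowerSeries.X ∣ T) (g : ℕ → R⟦X⟧) (N : ℕ) :
    PowerSeries.X ^ N ∣ evalSeq T g - ∑ s ∈ Finset.range N, g s * T ^ s := by
  rw [PowerSeries.X_pow_dvd_iff]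
  intro m hm
  rw [map_sub, evalSeq, PowerSeries.coeff_mk, ← map_sub, ← neg_sub, map_neg, neg_eq_zero,
    ← Finset.sum_range_add_sum_Ico _ (Nat.succ_le_of_lt hm), add_sub_cancel_left]
  refine PowerSeries.X_pow_dvd_iff.1 (Finset.dvd_sum fun s hs => ?_) m (Nat.lt_succ_self m)
  exact Dvd.dvd.mul_left ((pow_dvd_pow _ (Finset.mem_Ico.1 hs).1).trans (pow_dvd_pow_of_dvd hT s)) _

theorem evalSeq_add (f g : ℕ → R⟦X⟧) :
    evalSeq T (fun s => f s + g s) = evalSeq T f + evalSeq T g := by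
  ext m
  simp [evalSeq, add_mul, Finset.sum_add_distrib]

theorem eq_of_forall_X_pow_dvd_sub {f g : R⟦X⟧} (h : ∀ N : ℕ, PowerSeries.X ^ N ∣ f - g) :
    f = g := by
  rw [← sub_eq_zero]
  ext m
  simpa using PowerSeries.X_pow_dvd_iff.1 (h (m + 1)) m (Nat.lt_succ_self m)

theorem evalSeq_const_mul (hT : PowerSeries.X ∣ T) (c : R⟦X⟧) (g : ℕ → R⟦X⟧) :
    evalSeq T (fun s => c * g s) = c * evalSeq T g := by
  refine eq_of_forall_X_pow_dvd_sub fun N => ?_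
  have h1 := X_pow_dvd_evalSeq_sub hT (fun s => c * g s) N
  have h2 := (X_pow_dvd_evalSeq_sub hT g N).mul_left c
  convert dvd_sub h1 h2 using 1
  simp only [mul_assoc, ← Finset.mul_sum]
  ring

theorem evalSeq_eq_add_mul (hT : PowerSeries.X ∣ T) (g : ℕ → R⟦X⟧) :
    evalSeq T g = g 0 + T * evalSeq T (fun s => g (s + 1)) := by
  refine eq_of_forall_X_pow_dvd_sub fun N => ?_
  have h1 := (pow_dvd_pow _ (Nat.le_succ N)).trans (X_pow_dvd_evalSeq_sub hT g (N + 1))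
  have h2 := (X_pow_dvd_evalSeq_sub hT (fun s => g (s + 1)) N).mul_left T
  convert dvd_sub h1 h2 using 1
  rw [Finset.sum_range_succ']
  simp only [pow_succ', mul_sub, Finset.mul_sum, mul_left_comm T]
  ring

theorem one_sub_mul_evalSeq_sum (hT : PowerSeries.X ∣ T) (g : ℕ → R⟦X⟧) :
    (1 - T) * evalSeq T (fun s => ∑ r ∈ Finset.range (s + 1), g r) = evalSeq T g := by
  have h := evalSeq_eq_add_mul hT (fun s => ∑ r ∈ Finset.range (s + 1), g r)
  simp only [Finset.sum_range_succ _ (_ + 1)] at h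
  rw [evalSeq_add] at h
  rw [evalSeq_eq_add_mul hT g]
  simp only [zero_add, Finset.sum_range_one] at h
  linear_combination h

theorem one_sub_mul_evalSeq_weighted_sum (hT : PowerSeries.X ∣ T) (g : ℕ → R⟦X⟧) :
    (1 - T) * evalSeq T (fun s => ∑ r ∈ Finset.range (s + 1), ((s - r : ℕ) : R⟦X⟧) * g r) =
      T * evalSeq T (fun s => ∑ r ∈ Finset.range (s + 1), g r) := by
  have h := evalSeq_eq_add_mul hT
    (fun s => ∑ r ∈ Finset.range (s + 1), ((s - r : ℕ) : R⟦X⟧) * g r)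
  have hs (s : ℕ) : ∑ r ∈ Finset.range (s + 1 + 1), ((s + 1 - r : ℕ) : R⟦X⟧) * g r =
      ∑ r ∈ Finset.range (s + 1), ((s - r : ℕ) : R⟦X⟧) * g r +
        ∑ r ∈ Finset.range (s + 1), g r := by
    rw [Finset.sum_range_succ, Nat.sub_self, Nat.cast_zero, zero_mul, add_zero,
      ← Finset.sum_add_distrib]
    refine Finset.sum_congr rfl fun r hr => ?_
    rw [Nat.sub_add_comm (Nat.lt_succ_iff.1 (Finset.mem_range.1 hr))]
    push_cast
    ring
  simp only [hs] at h
  rw [evalSeq_add] at h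
  simp only [zero_add, Finset.sum_range_one, Nat.sub_self, Nat.cast_zero, zero_mul] at h
  linear_combination h

end evalSeq

theorem x_mul_y_ne_zero : x * y ≠ 0 := by
  refine mul_ne_zero ?_ PowerSeries.X_ne_zero
  rw [x, Ne, map_eq_zero_iff _ PowerSeries.C_injective]
  exact PowerSeries.X_ne_zero

/-- The kernel method: the kernel of the linear system for the series `stateSeries s` vanishes at
`(B - 1) / B`. -/
theorem x_mul_stateSeries_one {B : ℚ⟦X⟧⟦X⟧} (hB : FunctionalEquation B) :
    x * stateSeries 1 = x * B ^ 2 - (x - 1) * (B - 1) := by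
  have hBy : PowerSeries.X ∣ B - 1 := by
    rw [FunctionalEquation] at hB
    refine ⟨x * B ^ 2 * (x * B ^ 2 - (x - 1) * (B - 1)), ?_⟩
    have : (PowerSeries.X : ℚ⟦X⟧⟦X⟧) = y := rfl
    rw [this]
    linear_combination hB
  have hB0 : PowerSeries.constantCoeff B = 1 := by
    have := PowerSeries.X_dvd_iff.1 hBy
    rw [map_sub, map_one] at this
    exact sub_eq_zero.1 this
  have hBu : IsUnit B := by rw [PowerSeries.isUnit_iff_constantCoeff, hB0]; exact isUnit_one
  obtain ⟨D, hD⟩ := hBu.exists_right_inv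
  -- `T = (B - 1) / B`, so that `1 / (1 - T) = B`.
  obtain ⟨T, hTdef⟩ : ∃ T, T = (B - 1) * D := ⟨_, rfl⟩
  have hT : PowerSeries.X ∣ T := hTdef ▸ hBy.mul_right D
  have hBT : B * (1 - T) = 1 := by rw [hTdef]; linear_combination (1 - B) * hD
  let f : ℕ → ℚ⟦X⟧⟦X⟧ := fun s => stateSeries (s + 1)
  have hf := evalSeq_eq_add_mul hT f
  have hF := evalSeq_eq_add_mul hT stateSeries
  have hP := one_sub_mul_evalSeq_sum hT f
  have hS := one_sub_mul_evalSeq_sum hT (fun s => f (s + 1))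
  have hQ := one_sub_mul_evalSeq_weighted_sum hT f
  have hE : evalSeq T f = evalSeq T stateSeries + y * (x *
      evalSeq T (fun s => ∑ r ∈ Finset.range (s + 1), f r) + x ^ 2 *
        (evalSeq T (fun s => ∑ r ∈ Finset.range (s + 1), f (r + 1)) +
          evalSeq T (fun s => ∑ r ∈ Finset.range (s + 1), ((s - r : ℕ) : ℚ⟦X⟧⟦X⟧) * f r))) := by
    rw [← evalSeq_add, ← evalSeq_const_mul hT, ← evalSeq_const_mul hT, ← evalSeq_add,
      ← evalSeq_const_mul hT, ← evalSeq_add]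
    exact congrArg _ (funext stateSeries_succ)
  rw [stateSeries_zero] at hF
  change evalSeq T stateSeries = 1 + T * evalSeq T f at hF
  change evalSeq T f = stateSeries 1 + _ at hf
  generalize evalSeq T stateSeries = EF at *
  generalize evalSeq T (fun s => ∑ r ∈ Finset.range (s + 1), ((s - r : ℕ) : ℚ⟦X⟧⟦X⟧) * f r) = EQ
    at *
  generalize evalSeq T (fun s => ∑ r ∈ Finset.range (s + 1), f r) = EP at *
  generalize evalSeq T (fun s => ∑ r ∈ Finset.range (s + 1), f (r + 1)) = ES at *
  generalize evalSeq T (fun s => f (s + 1)) = Es at *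
  generalize evalSeq T f = E at *
  have hTB : T * B = B - 1 := by linear_combination -hBT
  have hEP : EP = B * E := by linear_combination B * hP - EP * hBT
  have hTS : T * ES = B * (E - stateSeries 1) := by
    linear_combination B * T * hS - T * ES * hBT - B * hf
  have hEQ : EQ = (B - 1) * B * E := by
    linear_combination B * hQ - EQ * hBT + EP * hTB + (B - 1) * hEP
  rw [FunctionalEquation] at hB
  have key : B - 1 = x ^ 2 * y * B ^ 2 * stateSeries 1 := by
    have h1 : T * E = T + T ^ 2 * E + x * y * B * T * E + x ^ 2 * y * (B * (E - stateSeries 1)) +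
        x ^ 2 * y * T * ((B - 1) * B * E) := by
      linear_combination T * hE + T * hF + x * y * T * hEP + x ^ 2 * y * hTS + x ^ 2 * y * T * hEQ
    apply mul_left_cancel₀ hBu.ne_zero
    -- After elimination of `T`, the factor multiplying `E` is the functional equation `hB`.
    linear_combination (B * E - B - (T * B + B - 1) * E - x * y * B ^ 2 * E -
      x ^ 2 * y * B ^ 2 * (B - 1) * E) * hTB - B ^ 2 * h1 + E * hB
  apply mul_left_cancel₀ x_mul_y_ne_zero
  apply mul_left_cancel₀ (pow_ne_zero 2 hBu.ne_zero)
  linear_combination hB - key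

/-! ### Inserting a maximal entry into a word -/

/-- The list `l` avoids the pattern `102`. -/
def ListAvoids102 : List ℕ → Prop
  | [] => True
  | b :: l => l.Pairwise (fun a c => a < b → c ≤ b) ∧ ListAvoids102 l

/-- The entries of `l` satisfy `l[i] ≤ i + k`. -/
def IsInversionFrom : ℕ → List ℕ → Prop
  | _, [] => True
  | k, a :: l => a ≤ k ∧ IsInversionFrom (k + 1) l

/-- The list `l` is an inversion sequence that avoids `102` and `000`. -/
def IsGood (l : List ℕ) : Prop :=
  ListAvoids102 l ∧ (∀ a, l.count a ≤ 2) ∧ IsInversionFrom 0 l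

theorem ListAvoids102.sublist {l₁ l₂ : List ℕ} (h : l₁.Sublist l₂) (h₂ : ListAvoids102 l₂) :
    ListAvoids102 l₁ := by
  induction h with
  | slnil => trivial
  | cons a _ ih => exact ih h₂.2
  | cons_cons a hs ih => exact ⟨h₂.1.sublist hs, ih h₂.2⟩

/-- No entry exceeds `v`, so `v` can only play the 2, and nothing before it may then form a descent.
Allowing `v` itself in `l₂` lets the lemma be used for the first of two copies. -/
theorem listAvoids102_append_cons {l₁ l₂ : List ℕ} {v : ℕ} (h₁ : ∀ a ∈ l₁, a < v)
    (h₂ : ∀ a ∈ l₂, a ≤ v) :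
    ListAvoids102 (l₁ ++ v :: l₂) ↔ ListAvoids102 (l₁ ++ l₂) ∧ l₁.Pairwise (· ≤ ·) := by
  induction l₁ with
  | nil =>
    simp only [List.nil_append, ListAvoids102, List.Pairwise.nil, and_true, and_iff_right_iff_imp]
    intro _
    exact (List.pairwise_of_forall_mem_list (fun a _ c hc _ => h₂ c hc))
  | cons b l ih =>
    have ih := ih (fun a ha => h₁ a (List.mem_cons_of_mem _ ha))
    have hb := h₁ b List.mem_cons_self
    simp only [List.cons_append, ListAvoids102, ih, List.pairwise_append, List.pairwise_cons,
      List.mem_cons]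
    constructor
    · rintro ⟨⟨p1, ⟨p2, p3⟩, p4⟩, p5, p6⟩
      refine ⟨⟨⟨p1, p3, fun a ha c hc => p4 a ha c (Or.inr hc)⟩, p5⟩, fun a ha => ?_, p6⟩
      by_contra hab
      exact absurd (p4 a ha v (Or.inl rfl) (not_le.1 hab)) (not_le.2 hb)
    · rintro ⟨⟨⟨p1, p2, p3⟩, p4⟩, p5, p6⟩
      refine ⟨⟨p1, ⟨fun c _ hvb => absurd hvb hb.not_gt, p2⟩, ?_⟩, p4, p6⟩
      rintro a ha c (rfl | hc) hab
      · exact absurd hab (p5 a ha).not_gt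
      · exact p3 a ha c hc hab

theorem IsInversionFrom.mono {l : List ℕ} {k k' : ℕ} (hk : k ≤ k') (h : IsInversionFrom k l) :
    IsInversionFrom k' l := by
  induction l generalizing k k' with
  | nil => trivial
  | cons a l ih => exact ⟨h.1.trans hk, ih (Nat.succ_le_succ hk) h.2⟩

theorem isInversionFrom_of_forall_le {l : List ℕ} {k : ℕ} (h : ∀ a ∈ l, a ≤ k) :
    IsInversionFrom k l := by
  induction l generalizing k with
  | nil => trivial
  | cons a l ih =>
    exact ⟨h a List.mem_cons_self,
      ih fun c hc => (h c (List.mem_cons_of_mem _ hc)).trans (Nat.le_succ k)⟩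

theorem isInversionFrom_append {l₁ l₂ : List ℕ} {k : ℕ} :
    IsInversionFrom k (l₁ ++ l₂) ↔
      IsInversionFrom k l₁ ∧ IsInversionFrom (k + l₁.length) l₂ := by
  induction l₁ generalizing k with
  | nil => simp [IsInversionFrom]
  | cons a l ih =>
    simp only [List.cons_append, IsInversionFrom, ih, List.length_cons, and_assoc]
    rw [show k + 1 + l.length = k + (l.length + 1) by ring]

theorem isInversionFrom_append_cons {l₁ l₂ : List ℕ} {v : ℕ} (h₂ : ∀ a ∈ l₂, a ≤ v) :
    IsInversionFrom 0 (l₁ ++ v :: l₂) ↔ IsInversionFrom 0 (l₁ ++ l₂) ∧ v ≤ l₁.length := by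
  simp only [isInversionFrom_append, IsInversionFrom, zero_add]
  constructor
  · rintro ⟨p1, p2, p3⟩
    exact ⟨⟨p1, isInversionFrom_of_forall_le fun a ha => (h₂ a ha).trans p2⟩, p2⟩
  · rintro ⟨⟨p1, p2⟩, p3⟩
    exact ⟨p1, p3, p2.mono (Nat.le_succ _)⟩

/-- Deletion shifts entries left, but the first deleted entry is at least `v`, so its bound already
exceeds every later surviving entry. -/
theorem IsInversionFrom.filter_lt {l : List ℕ} {k : ℕ} (h : IsInversionFrom k l) (v : ℕ) :
    IsInversionFrom k (l.filter (· < v)) := by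
  induction l generalizing k with
  | nil => trivial
  | cons a l ih =>
    by_cases hav : a < v
    · rw [List.filter_cons_of_pos (by simpa using hav)]
      exact ⟨h.1, ih h.2⟩
    · rw [List.filter_cons_of_neg (by simpa using hav)]
      refine isInversionFrom_of_forall_le fun c hc => ?_
      have hc : c < v := by simpa using (List.mem_filter.1 hc).2
      exact hc.le.trans ((not_lt.1 hav).trans h.1)

theorem IsGood.filter_lt {l : List ℕ} (h : IsGood l) (v : ℕ) : IsGood (l.filter (· < v)) :=
  ⟨h.1.sublist List.filter_sublist, fun a => (List.filter_sublist.count_le a).trans (h.2.1 a),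
    h.2.2.filter_lt v⟩

/-! ### Admissible slots and the generation of all good words -/

/-- The length of the longest weakly increasing prefix. -/
def runLength (l : List ℕ) : ℕ :=
  Nat.findGreatest (fun i => (l.take i).Pairwise (· ≤ ·)) l.length

theorem runLength_le (l : List ℕ) : runLength l ≤ l.length := Nat.findGreatest_le _

theorem length_le_runLength_append {l₁ l₂ : List ℕ} :
    l₁.length ≤ runLength (l₁ ++ l₂) ↔ l₁.Pairwise (· ≤ ·) := by
  constructor
  · intro h
    have h1 : ((l₁ ++ l₂).take (runLength (l₁ ++ l₂))).Pairwise (· ≤ ·) :=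
      Nat.findGreatest_spec (P := fun i => ((l₁ ++ l₂).take i).Pairwise (· ≤ ·))
        (Nat.zero_le _) (by simp)
    have h2 := h1.sublist (List.take_sublist l₁.length _)
    rwa [List.take_take, min_eq_left h, List.take_left] at h2
  · intro h
    exact Nat.le_findGreatest (by simp) (by simpa using h)

theorem runLength_append {l₁ l₂ : List ℕ} (h₁ : l₁.Pairwise (· ≤ ·))
    (h₂ : ∀ b ∈ l₂.head?, ∃ a ∈ l₁, b < a) : runLength (l₁ ++ l₂) = l₁.length := by
  refine le_antisymm ?_ (length_le_runLength_append.2 h₁)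
  rcases l₂ with _ | ⟨b, l⟩
  · simpa using runLength_le l₁
  · obtain ⟨a, ha, hba⟩ := h₂ b (by simp)
    by_contra hlt
    have h3 : (l₁ ++ [b]).length ≤ runLength ((l₁ ++ [b]) ++ l) := by simpa using hlt
    rw [length_le_runLength_append, List.pairwise_append] at h3
    exact absurd (h3.2.2 a ha b (by simp)) hba.not_ge

/-- The words obtained from `w` by inserting at most two copies of `v` into the slots `i` with
`v ≤ i ≤ runLength w`. -/
def children (v : ℕ) (w : List ℕ) : Finset (List ℕ) :=
  insert w ((Finset.Icc v (runLength w)).image (fun i => w.insertIdx i v) ∪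
    ((Finset.Icc v (runLength w)).sigma fun i => Finset.Icc i (runLength w)).image
      (fun q : (_ : ℕ) × ℕ => (w.insertIdx q.2 v).insertIdx q.1 v))

theorem insertIdx_append_length (l₁ l₂ : List ℕ) (v : ℕ) :
    (l₁ ++ l₂).insertIdx l₁.length v = l₁ ++ v :: l₂ := by
  induction l₁ with
  | nil => simp
  | cons a l ih => simpa using ih

theorem exists_insertIdx_eq {w : List ℕ} {i : ℕ} (v : ℕ) (hi : i ≤ w.length) :
    ∃ l₁ l₂, w = l₁ ++ l₂ ∧ l₁.length = i ∧ w.insertIdx i v = l₁ ++ v :: l₂ := by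
  have hl : (w.take i).length = i := by simpa using hi
  have h := insertIdx_append_length (w.take i) (w.drop i) v
  rw [hl, List.take_append_drop] at h
  exact ⟨w.take i, w.drop i, by simp, hl, h⟩

theorem exists_insertIdx_insertIdx_eq {w : List ℕ} {i j : ℕ} (v : ℕ) (hij : i ≤ j)
    (hj : j ≤ w.length) :
    ∃ l₁ l₂ l₃, w = l₁ ++ (l₂ ++ l₃) ∧ l₁.length = i ∧ l₁.length + l₂.length = j ∧
      (w.insertIdx j v).insertIdx i v = l₁ ++ v :: (l₂ ++ v :: l₃) := by
  obtain ⟨l, l₃, rfl, rfl, h⟩ := exists_insertIdx_eq v hj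
  obtain ⟨l₁, l₂, rfl, rfl, -⟩ := exists_insertIdx_eq v hij
  refine ⟨l₁, l₂, l₃, by simp, rfl, by simp, ?_⟩
  rw [h, List.append_assoc, insertIdx_append_length]

theorem filter_lt_cons_self (v : ℕ) (l : List ℕ) :
    (v :: l).filter (· < v) = l.filter (· < v) :=
  List.filter_cons_of_neg (by simp)

theorem filter_lt_eq_self {l : List ℕ} {v : ℕ} (h : ∀ a ∈ l, a < v) : l.filter (· < v) = l :=
  List.filter_eq_self.2 (by simpa using h)

theorem count_eq_zero_of_forall_lt {l : List ℕ} {v : ℕ} (h : ∀ a ∈ l, a < v) : l.count v = 0 :=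
  List.count_eq_zero_of_not_mem fun hv => (h v hv).false

theorem forall_lt_of_forall_le {l : List ℕ} {v : ℕ} (h : ∀ a ∈ l, a ≤ v) (hv : v ∉ l) :
    ∀ a ∈ l, a < v :=
  fun a ha => lt_of_le_of_ne (h a ha) fun hav => hv (hav ▸ ha)

theorem isGood_append_cons {l₁ l₂ : List ℕ} {v : ℕ} (h₁ : ∀ a ∈ l₁, a < v)
    (h₂ : ∀ a ∈ l₂, a < v) :
    IsGood (l₁ ++ v :: l₂) ↔
      IsGood (l₁ ++ l₂) ∧ l₁.Pairwise (· ≤ ·) ∧ v ≤ l₁.length := by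
  have hc : (∀ a, (l₁ ++ v :: l₂).count a ≤ 2) ↔ ∀ a, (l₁ ++ l₂).count a ≤ 2 := by
    refine forall_congr' fun a => ?_
    rcases eq_or_ne a v with rfl | hav
    · simp [List.count_append, count_eq_zero_of_forall_lt h₁, count_eq_zero_of_forall_lt h₂]
    · simp [List.count_append, List.count_cons_of_ne hav.symm]
  rw [IsGood, IsGood, hc, listAvoids102_append_cons h₁ fun a ha => (h₂ a ha).le,
    isInversionFrom_append_cons fun a ha => (h₂ a ha).le]
  tauto

theorem isGood_append_cons_append_cons {l₁ l₂ l₃ : List ℕ} {v : ℕ} (h₁ : ∀ a ∈ l₁, a < v)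
    (h₂ : ∀ a ∈ l₂, a < v) (h₃ : ∀ a ∈ l₃, a < v) :
    IsGood (l₁ ++ v :: (l₂ ++ v :: l₃)) ↔
      IsGood (l₁ ++ (l₂ ++ l₃)) ∧ (l₁ ++ l₂).Pairwise (· ≤ ·) ∧ v ≤ l₁.length := by
  have hc : (∀ a, (l₁ ++ v :: (l₂ ++ v :: l₃)).count a ≤ 2) ↔
      ∀ a, (l₁ ++ (l₂ ++ l₃)).count a ≤ 2 := by
    refine forall_congr' fun a => ?_
    rcases eq_or_ne a v with rfl | hav
    · simp [List.count_append, count_eq_zero_of_forall_lt h₁, count_eq_zero_of_forall_lt h₂,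
        count_eq_zero_of_forall_lt h₃]
    · simp [List.count_append, List.count_cons_of_ne hav.symm]
  have h₃' : ∀ a ∈ l₃, a ≤ v := fun a ha => (h₃ a ha).le
  have h₂₃ : ∀ a ∈ l₂ ++ v :: l₃, a ≤ v := by
    simp only [List.mem_append, List.mem_cons]
    rintro a (ha | rfl | ha)
    exacts [(h₂ a ha).le, le_rfl, h₃' a ha]
  have h₁₂ : ∀ a ∈ l₁ ++ l₂, a < v := by
    simp only [List.mem_append]
    rintro a (ha | ha)
    exacts [h₁ a ha, h₂ a ha]
  rw [IsGood, IsGood, hc, listAvoids102_append_cons h₁ h₂₃, isInversionFrom_append_cons h₂₃,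
    ← List.append_assoc, listAvoids102_append_cons h₁₂ h₃', isInversionFrom_append_cons h₃',
    List.append_assoc, List.length_append]
  constructor
  · rintro ⟨⟨⟨p1, p2⟩, p3⟩, p4, ⟨p5, p6⟩, p7⟩
    exact ⟨⟨p1, p4, p5⟩, p2, p7⟩
  · rintro ⟨⟨p1, p4, p5⟩, p2, p7⟩
    exact ⟨⟨⟨p1, p2⟩, p2.sublist (List.sublist_append_left _ _)⟩, p4, ⟨p5, by omega⟩, p7⟩

/-- Splitting a word at its occurrences of `v`, of which there are at most two, recovers the slots
used. The filter recovers the parent, so each good word arises from just one. -/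
theorem mem_children_iff {v : ℕ} {w l : List ℕ} (hw : IsGood w) (hwv : ∀ a ∈ w, a < v) :
    l ∈ children v w ↔ IsGood l ∧ (∀ a ∈ l, a ≤ v) ∧ l.filter (· < v) = w := by
  simp only [children, Finset.mem_insert, Finset.mem_union, Finset.mem_image, Finset.mem_Icc,
    Finset.mem_sigma, Sigma.exists]
  constructor
  · rintro (rfl | ⟨i, ⟨hvi, hi⟩, rfl⟩ | ⟨i, j, ⟨⟨hvi, -⟩, hij, hj⟩, rfl⟩)
    · exact ⟨hw, fun a ha => (hwv a ha).le, filter_lt_eq_self hwv⟩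
    · obtain ⟨l₁, l₂, rfl, rfl, h⟩ := exists_insertIdx_eq v (hi.trans (runLength_le w))
      rw [length_le_runLength_append] at hi
      simp only [List.mem_append, or_imp, forall_and] at hwv
      rw [h, isGood_append_cons hwv.1 hwv.2, List.filter_append, filter_lt_cons_self,
        filter_lt_eq_self hwv.1, filter_lt_eq_self hwv.2]
      refine ⟨⟨hw, hi, hvi⟩, ?_, rfl⟩
      simp only [List.mem_append, List.mem_cons]
      rintro a (ha | rfl | ha)
      exacts [(hwv.1 a ha).le, le_rfl, (hwv.2 a ha).le]
    · obtain ⟨l₁, l₂, l₃, rfl, rfl, rfl, h⟩ :=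
        exists_insertIdx_insertIdx_eq v hij (hj.trans (runLength_le w))
      rw [← List.append_assoc, ← List.length_append, length_le_runLength_append] at hj
      simp only [List.mem_append, or_imp, forall_and] at hwv
      obtain ⟨h₁, h₂, h₃⟩ := hwv
      rw [h, isGood_append_cons_append_cons h₁ h₂ h₃]
      refine ⟨⟨hw, hj, hvi⟩, ?_, ?_⟩
      · simp only [List.mem_append, List.mem_cons]
        rintro a (ha | rfl | ha | rfl | ha)
        exacts [(h₁ a ha).le, le_rfl, (h₂ a ha).le, le_rfl, (h₃ a ha).le]
      · rw [List.filter_append, filter_lt_cons_self, List.filter_append,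
          filter_lt_cons_self, filter_lt_eq_self h₁, filter_lt_eq_self h₂,
          filter_lt_eq_self h₃]
  · rintro ⟨hl, hlv, rfl⟩
    by_cases hv : v ∈ l
    · right
      obtain ⟨l₁, l', rfl, hv₁⟩ := List.eq_append_cons_of_mem hv
      simp only [List.mem_append, List.mem_cons, or_imp, forall_and] at hlv
      have h₁ := forall_lt_of_forall_le hlv.1 hv₁
      by_cases hv' : v ∈ l'
      · right
        obtain ⟨l₂, l₃, rfl, hv₂⟩ := List.eq_append_cons_of_mem hv'
        have hv₃ : v ∉ l₃ := by
          intro hv₃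
          have h := hl.2.1 v
          have := List.count_pos_iff.2 hv₃
          simp [List.count_append] at h
          omega
        simp only [List.mem_append, List.mem_cons, or_imp, forall_and] at hlv
        have h₂ := forall_lt_of_forall_le hlv.2.2.1 hv₂
        have h₃ := forall_lt_of_forall_le hlv.2.2.2.2 hv₃
        rw [isGood_append_cons_append_cons h₁ h₂ h₃] at hl
        rw [List.filter_append, filter_lt_cons_self, List.filter_append,
          filter_lt_cons_self, filter_lt_eq_self h₁, filter_lt_eq_self h₂,
          filter_lt_eq_self h₃]
        have hr := length_le_runLength_append (l₂ := l₃).2 hl.2.1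
        rw [List.append_assoc, List.length_append] at hr
        refine ⟨l₁.length, l₁.length + l₂.length, ⟨⟨hl.2.2, by omega⟩, by omega, hr⟩, ?_⟩
        rw [← List.length_append, ← List.append_assoc, insertIdx_append_length, List.append_assoc,
          insertIdx_append_length]
      · left
        have h₂ := forall_lt_of_forall_le hlv.2.2 hv'
        rw [isGood_append_cons h₁ h₂] at hl
        rw [List.filter_append, filter_lt_cons_self, filter_lt_eq_self h₁,
          filter_lt_eq_self h₂]
        exact ⟨l₁.length, ⟨hl.2.2, length_le_runLength_append.2 hl.2.1⟩,
          insertIdx_append_length _ _ _⟩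
    · left
      exact (filter_lt_eq_self (forall_lt_of_forall_le hlv hv)).symm

/-- The good words with entries less than `v`. -/
def goodWords : ℕ → Finset (List ℕ)
  | 0 => {[]}
  | v + 1 => (goodWords v).biUnion (children v)

theorem mem_goodWords_iff {v : ℕ} {l : List ℕ} :
    l ∈ goodWords v ↔ IsGood l ∧ ∀ a ∈ l, a < v := by
  induction v generalizing l with
  | zero =>
    simp only [goodWords, Finset.mem_singleton, not_lt_zero, imp_false]
    rw [← List.eq_nil_iff_forall_not_mem]
    refine ⟨?_, fun h => h.2⟩
    rintro rfl
    exact ⟨⟨trivial, by simp, trivial⟩, rfl⟩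
  | succ v ih =>
    simp only [goodWords, Finset.mem_biUnion, ih, Nat.lt_succ_iff]
    constructor
    · rintro ⟨w, ⟨hw, hwv⟩, hl⟩
      have := (mem_children_iff hw hwv).1 hl
      exact ⟨this.1, this.2.1⟩
    · rintro ⟨hl, hlv⟩
      have hf : IsGood (l.filter (· < v)) := hl.filter_lt v
      have hfv : ∀ a ∈ l.filter (· < v), a < v := fun a ha => by
        simpa using (List.mem_filter.1 ha).2
      exact ⟨_, ⟨hf, hfv⟩, (mem_children_iff hf hfv).2 ⟨hl, hlv, rfl⟩⟩

/-! ### The generating function is preserved by insertion -/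

/-- The generating function of the good words obtained from `w` by inserting entries that are at
least `v`. -/
noncomputable def wordSeries (v : ℕ) (w : List ℕ) : ℚ⟦X⟧⟦X⟧ :=
  x ^ w.length * y ^ w.toFinset.card * stateSeries (runLength w + 1 - v)

theorem wordSeries_insertIdx {v i : ℕ} {w : List ℕ} (hwv : ∀ a ∈ w, a < v)
    (hi : i ≤ runLength w) :
    wordSeries (v + 1) (w.insertIdx i v) =
      x ^ w.length * y ^ w.toFinset.card * (y * (x * stateSeries (i + 1 - v))) := by
  have hvw : v ∉ w := fun h => (hwv v h).false
  obtain ⟨l₁, l₂, rfl, rfl, h⟩ := exists_insertIdx_eq v (hi.trans (runLength_le w))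
  rw [length_le_runLength_append] at hi
  have hcard : (l₁ ++ v :: l₂).toFinset.card = (l₁ ++ l₂).toFinset.card + 1 := by
    rw [← Finset.card_insert_of_notMem (by simpa using hvw)]
    congr 1
    ext a
    simp
  simp only [List.mem_append, or_imp, forall_and] at hwv
  have hrun : runLength (l₁ ++ v :: l₂) = l₁.length + 1 := by
    have := runLength_append (l₁ := l₁ ++ [v]) (l₂ := l₂)
      (List.pairwise_append.2 ⟨hi, List.pairwise_singleton _ _, by
        simpa using fun a ha => (hwv.1 a ha).le⟩)
      (fun b hb => ⟨v, by simp, hwv.2 b (List.mem_of_mem_head? hb)⟩)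
    simpa using this
  rw [wordSeries, h, hcard, hrun, Nat.add_sub_add_right]
  simp only [List.length_append, List.length_cons]
  ring

theorem wordSeries_insertIdx_insertIdx {v i j : ℕ} {w : List ℕ} (hwv : ∀ a ∈ w, a < v)
    (hij : i ≤ j) (hj : j ≤ runLength w) :
    wordSeries (v + 1) ((w.insertIdx j v).insertIdx i v) =
      x ^ w.length * y ^ w.toFinset.card *
        (y * (x ^ 2 * stateSeries (if i = j then i + 2 - v else i + 1 - v))) := by
  have hvw : v ∉ w := fun h => (hwv v h).false
  obtain ⟨l₁, l₂, l₃, rfl, rfl, rfl, h⟩ :=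
    exists_insertIdx_insertIdx_eq v hij (hj.trans (runLength_le w))
  rw [← List.append_assoc, ← List.length_append, length_le_runLength_append] at hj
  have hcard : (l₁ ++ v :: (l₂ ++ v :: l₃)).toFinset.card =
      (l₁ ++ (l₂ ++ l₃)).toFinset.card + 1 := by
    rw [← Finset.card_insert_of_notMem (by simpa using hvw)]
    congr 1
    ext a
    simp
  simp only [List.mem_append, or_imp, forall_and] at hwv
  obtain ⟨h₁, h₂, h₃⟩ := hwv
  have hl₁ : (l₁ ++ [v]).Pairwise (· ≤ ·) :=
    List.pairwise_append.2 ⟨hj.sublist (List.sublist_append_left _ _),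
      List.pairwise_singleton _ _, by simpa using fun a ha => (h₁ a ha).le⟩
  -- The run ends just before the first entry smaller than `v` that follows a `v`, hence after both
  -- copies only when they are adjacent.
  have hrun : runLength (l₁ ++ v :: (l₂ ++ v :: l₃)) + 1 - (v + 1) =
      if l₁.length = l₁.length + l₂.length then l₁.length + 2 - v else l₁.length + 1 - v := by
    rcases l₂ with _ | ⟨b, l₂⟩
    · have := runLength_append (l₁ := l₁ ++ [v] ++ [v]) (l₂ := l₃)
        (List.pairwise_append.2 ⟨hl₁, List.pairwise_singleton _ _, by
          simpa [or_imp, forall_and] using fun a ha => (h₁ a ha).le⟩)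
        (fun b hb => ⟨v, by simp, h₃ b (List.mem_of_mem_head? hb)⟩)
      simp at this
      simp [this]
    · have := runLength_append (l₁ := l₁ ++ [v]) (l₂ := b :: l₂ ++ v :: l₃) hl₁
        (fun c hc => ⟨v, by simp, h₂ c (by simp at hc; simp [hc])⟩)
      simp at this
      simp [this]
  rw [wordSeries, h, hcard, hrun]
  simp only [List.length_append, List.length_cons]
  ring

theorem idxOf_insertIdx {v i : ℕ} {w : List ℕ} (hvw : v ∉ w.take i) (hi : i ≤ w.length) :
    (w.insertIdx i v).idxOf v = i := by
  obtain ⟨l₁, l₂, rfl, rfl, h⟩ := exists_insertIdx_eq v hi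
  rw [List.take_left] at hvw
  rw [h, List.idxOf_append_of_notMem hvw]
  simp

/-- The recurrence `stateSeries_succ` read on words. The number of copies of `v` separates the three
kinds of children; the position of the first `v`, then that of the other, separates children of one
kind. -/
theorem sum_children {v : ℕ} {w : List ℕ} (hwv : ∀ a ∈ w, a < v) :
    ∑ l ∈ children v w, wordSeries (v + 1) l = wordSeries v w := by
  have hvw : v ∉ w := fun h => (hwv v h).false
  have hlen := runLength_le w
  have hcount₁ (i : ℕ) (hi : i ≤ runLength w) : (w.insertIdx i v).count v = 1 := by
    obtain ⟨l₁, l₂, rfl, rfl, h⟩ := exists_insertIdx_eq v (hi.trans hlen)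
    have := List.count_eq_zero_of_not_mem hvw
    rw [h]
    simp [List.count_append] at this ⊢
    omega
  have hcount₂ (i j : ℕ) (hij : i ≤ j) (hj : j ≤ runLength w) :
      ((w.insertIdx j v).insertIdx i v).count v = 2 := by
    obtain ⟨l₁, l₂, l₃, rfl, rfl, rfl, h⟩ := exists_insertIdx_insertIdx_eq v hij (hj.trans hlen)
    have := List.count_eq_zero_of_not_mem hvw
    rw [h]
    simp [List.count_append] at this ⊢
    omega
  have hcount₀ := List.count_eq_zero_of_not_mem hvw
  have hinj₁ : Set.InjOn (fun i => w.insertIdx i v) (Finset.Icc v (runLength w)) := by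
    intro i hi i' hi' h
    simp only [Finset.coe_Icc, Set.mem_Icc] at hi hi'
    have h' := congrArg (List.idxOf v) h
    rwa [idxOf_insertIdx (fun h => hvw (List.mem_of_mem_take h)) (hi.2.trans hlen),
      idxOf_insertIdx (fun h => hvw (List.mem_of_mem_take h)) (hi'.2.trans hlen)] at h'
  have hinj₂ : Set.InjOn (fun q : (_ : ℕ) × ℕ => (w.insertIdx q.2 v).insertIdx q.1 v)
      ((Finset.Icc v (runLength w)).sigma fun i => Finset.Icc i (runLength w)) := by
    have hidx (i j : ℕ) (hij : i ≤ j) (hj : j ≤ runLength w) :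
        ((w.insertIdx j v).insertIdx i v).idxOf v = i := by
      obtain ⟨l₁, l₂, l₃, rfl, rfl, rfl, h⟩ := exists_insertIdx_insertIdx_eq v hij (hj.trans hlen)
      rw [h, List.idxOf_append_of_notMem (by simp at hvw; tauto)]
      simp
    rintro ⟨i, j⟩ hq ⟨i', j'⟩ hq' h
    simp only [Finset.coe_sigma, Set.mem_sigma_iff, Finset.coe_Icc, Set.mem_Icc] at hq hq' h
    have h' := congrArg (List.idxOf v) h
    rw [hidx i j hq.2.1 hq.2.2, hidx i' j' hq'.2.1 hq'.2.2] at h'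
    subst h'
    have h'' := List.insertIdx_injective i v h
    have := congrArg (List.idxOf v) h''
    rw [idxOf_insertIdx (fun h => hvw (List.mem_of_mem_take h)) (hq.2.2.trans hlen),
      idxOf_insertIdx (fun h => hvw (List.mem_of_mem_take h)) (hq'.2.2.trans hlen)] at this
    rw [this]
  rw [children, Finset.sum_insert, Finset.sum_union, Finset.sum_image hinj₁,
    Finset.sum_image hinj₂, Finset.sum_sigma]
  rotate_left
  · rw [Finset.disjoint_left]
    intro l hl hl'
    simp only [Finset.mem_image, Finset.mem_sigma, Finset.mem_Icc, Sigma.exists] at hl hl'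
    obtain ⟨i, hi, rfl⟩ := hl
    obtain ⟨i', j', hq, h⟩ := hl'
    have := hcount₂ i' j' hq.2.1 hq.2.2
    rw [h, hcount₁ i hi.2] at this
    omega
  · simp only [Finset.mem_union, Finset.mem_image, Finset.mem_sigma, Finset.mem_Icc, Sigma.exists]
    rintro (⟨i, hi, h⟩ | ⟨i, j, hq, h⟩)
    · have := hcount₁ i hi.2
      rw [h] at this
      omega
    · have := hcount₂ i j hq.2.1 hq.2.2
      rw [h] at this
      omega
  have hsum₁ := Finset.sum_congr rfl fun i (hi : i ∈ Finset.Icc v (runLength w)) =>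
    wordSeries_insertIdx hwv (Finset.mem_Icc.1 hi).2
  have hsum₂ : ∑ i ∈ Finset.Icc v (runLength w), ∑ j ∈ Finset.Icc i (runLength w),
      wordSeries (v + 1) ((w.insertIdx j v).insertIdx i v) =
      ∑ i ∈ Finset.Icc v (runLength w), x ^ w.length * y ^ w.toFinset.card * (y * (x ^ 2 *
        (stateSeries (i + 2 - v) +
          ((runLength w - i : ℕ) : ℚ⟦X⟧⟦X⟧) * stateSeries (i + 1 - v)))) := by
    refine Finset.sum_congr rfl fun i hi => ?_
    have hi := (Finset.mem_Icc.1 hi).2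
    rw [← Finset.Ioc_insert_left hi, Finset.sum_insert (by simp),
      wordSeries_insertIdx_insertIdx hwv le_rfl hi, if_pos rfl,
      Finset.sum_congr rfl (fun j hj => by
        rw [wordSeries_insertIdx_insertIdx hwv (Finset.mem_Ioc.1 hj).1.le (Finset.mem_Ioc.1 hj).2,
          if_neg (Finset.mem_Ioc.1 hj).1.ne]), Finset.sum_const, Nat.card_Ioc, nsmul_eq_mul]
    ring
  rw [hsum₁, hsum₂, wordSeries, wordSeries, Nat.add_sub_add_right]
  -- Without slots the only child is `w`, and truncated subtraction makes both state indices 0.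
  rcases Nat.lt_or_ge (runLength w) v with h | h
  · simp [Finset.Icc_eq_empty (not_le.2 h), Nat.sub_eq_zero_of_le h.le,
      Nat.sub_eq_zero_of_le (Nat.succ_le_of_lt h)]
  · obtain ⟨s, hs⟩ := Nat.exists_eq_add_of_le h
    rw [hs, show v + s + 1 - v = s + 1 by omega, stateSeries_succ, insertionSeries,
      ← Finset.Ico_add_one_right_eq_Icc, Finset.sum_Ico_eq_sum_range, Finset.sum_Ico_eq_sum_range,
      show v + s + 1 - v = s + 1 by omega, Nat.add_sub_cancel_left]
    simp only [Nat.add_sub_add_left, add_assoc, Nat.add_sub_cancel_left]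
    rw [← Finset.mul_sum, ← Finset.mul_sum, ← Finset.mul_sum, ← Finset.mul_sum, ← Finset.mul_sum,
      ← Finset.mul_sum, Finset.sum_add_distrib]
    ring

theorem sum_goodWords (v : ℕ) : ∑ w ∈ goodWords v, wordSeries v w = stateSeries 1 := by
  induction v with
  | zero => simp [goodWords, wordSeries, runLength]
  | succ v ih =>
    rw [goodWords, Finset.sum_biUnion, ← ih]
    · exact Finset.sum_congr rfl fun w hw => sum_children (mem_goodWords_iff.1 hw).2
    · intro w hw w' hw' hne
      rw [Function.onFun, Finset.disjoint_left]
      intro l hl hl'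
      have hw := mem_goodWords_iff.1 hw
      have hw' := mem_goodWords_iff.1 hw'
      exact hne (((mem_children_iff hw.1 hw.2).1 hl).2.2.symm.trans
        ((mem_children_iff hw'.1 hw'.2).1 hl').2.2)

theorem coeffXY_x_pow_mul_y_pow_mul (n m k d : ℕ) (f : ℚ⟦X⟧⟦X⟧) :
    coeffXY n m (x ^ k * y ^ d * f) =
      if k ≤ n ∧ d ≤ m then coeffXY (n - k) (m - d) f else 0 := by
  rw [coeffXY, x, y, ← map_pow, mul_assoc, PowerSeries.coeff_C_mul, PowerSeries.coeff_X_pow_mul',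
    PowerSeries.coeff_X_pow_mul']
  split_ifs <;> simp_all [coeffXY]

/-- After the values up to `n`, a word of length at most `n` has no slots left, so its series is a
monomial; longer words do not reach `x ^ n`. -/
theorem coeffXY_stateSeries_one (n m : ℕ) :
    coeffXY n m (stateSeries 1) =
      (((goodWords (n + 1)).filter fun w => w.length = n ∧ w.toFinset.card = m).card : ℚ) := by
  rw [← sum_goodWords (n + 1), Finset.card_filter]
  push_cast
  rw [coeffXY, map_sum, map_sum]
  refine Finset.sum_congr rfl fun w _ => ?_
  change coeffXY n m (wordSeries (n + 1) w) = _
  rw [wordSeries, coeffXY_x_pow_mul_y_pow_mul]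
  by_cases hn : w.length ≤ n
  · have := runLength_le w
    rw [show runLength w + 1 - (n + 1) = 0 by omega, stateSeries_zero, coeffXY,
      PowerSeries.coeff_one]
    by_cases hm : w.toFinset.card ≤ m
    · rw [if_pos ⟨hn, hm⟩]
      by_cases hm' : w.toFinset.card = m
      · rw [if_pos (by omega), PowerSeries.coeff_one]
        exact if_congr (by omega) rfl rfl
      · rw [if_neg (by omega), if_neg (by tauto), map_zero]
    · rw [if_neg (by tauto), if_neg (by omega)]
  · rw [if_neg (by tauto), if_neg (by omega)]

/-! ### From patterns in functions to conditions on lists -/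

theorem reduction_lt_reduction_iff {k : ℕ} (w : Fin k → ℕ) (i j : Fin k) :
    reduction w i < reduction w j ↔ w i < w j := by
  have hle {i j : Fin k} (h : w i ≤ w j) : reduction w i ≤ reduction w j :=
    Finset.card_le_card (Finset.monotone_filter_right _ fun a _ ha => lt_of_lt_of_le ha h)
  constructor
  · intro h
    by_contra hij
    exact absurd (hle (not_lt.1 hij)) (not_le.2 h)
  · intro h
    refine Finset.card_lt_card (Finset.ssubset_iff.2 ⟨w i, by simp, ?_⟩)
    intro a ha
    simp only [Finset.mem_insert, Finset.mem_filter] at ha ⊢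
    rcases ha with rfl | ⟨ha, hai⟩
    · exact ⟨Finset.mem_image_of_mem _ (Finset.mem_univ _), h⟩
    · exact ⟨ha, hai.trans h⟩

theorem reduction_eq_102_iff (w : Fin 3 → ℕ) :
    reduction w = ![1, 0, 2] ↔ w 1 < w 0 ∧ w 0 < w 2 := by
  constructor
  · intro h
    rw [← reduction_lt_reduction_iff w, ← reduction_lt_reduction_iff w, h]
    decide
  · rintro ⟨h1, h2⟩
    have himg : Finset.univ.image w = {w 0, w 1, w 2} := by
      ext a
      simp [Fin.exists_fin_succ, eq_comm]
    funext i
    rw [reduction, himg]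
    fin_cases i
    · simp [Finset.filter_insert, Finset.filter_singleton, h1, h2.not_gt]
    · simp [Finset.filter_insert, Finset.filter_singleton, h1.not_gt, (h1.trans h2).not_gt]
    · simp [Finset.filter_insert, Finset.filter_singleton, h2, h1.trans h2, h1.ne']

theorem reduction_eq_000_iff (w : Fin 3 → ℕ) :
    reduction w = ![0, 0, 0] ↔ w 0 = w 1 ∧ w 1 = w 2 := by
  constructor
  · intro h
    have h' (i j : Fin 3) : ¬ w i < w j := by
      rw [← reduction_lt_reduction_iff w, h]
      fin_cases i <;> fin_cases j <;> simp
    exact ⟨le_antisymm (not_lt.1 (h' _ _)) (not_lt.1 (h' _ _)),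
      le_antisymm (not_lt.1 (h' _ _)) (not_lt.1 (h' _ _))⟩
  · rintro ⟨h1, h2⟩
    have himg : Finset.univ.image w = {w 0} := by
      ext a
      simp [Fin.exists_fin_succ, ← h2, ← h1, eq_comm]
    funext i
    rw [reduction, himg]
    fin_cases i <;> simp [Finset.filter_singleton, ← h2, ← h1]

theorem exists_strictMono_fin_three_iff {n : ℕ} (p : (Fin 3 → Fin n) → Prop) :
    (∃ f : Fin 3 → Fin n, StrictMono f ∧ p f) ↔ ∃ i j k, i < j ∧ j < k ∧ p ![i, j, k] := by
  constructor
  · rintro ⟨f, hf, hp⟩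
    refine ⟨f 0, f 1, f 2, hf (by decide), hf (by decide), ?_⟩
    convert hp using 1
    funext i
    fin_cases i <;> rfl
  · rintro ⟨i, j, k, hij, hjk, hp⟩
    refine ⟨_, ?_, hp⟩
    rw [Fin.strictMono_iff_lt_succ]
    intro a
    fin_cases a <;> simpa

theorem listAvoids102_iff_getElem {l : List ℕ} :
    ListAvoids102 l ↔ ∀ (i j k : ℕ) (_ : i < j) (_ : j < k) (hk : k < l.length),
      l[j] < l[i] → l[k] ≤ l[i] := by
  induction l with
  | nil => simp [ListAvoids102]
  | cons b l ih =>
    rw [ListAvoids102, ih, List.pairwise_iff_getElem]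
    constructor
    · rintro ⟨h1, h2⟩ i j k hij hjk hk
      obtain ⟨j, rfl⟩ := Nat.exists_eq_succ_of_ne_zero (Nat.ne_zero_of_lt hij)
      obtain ⟨k, rfl⟩ := Nat.exists_eq_succ_of_ne_zero (Nat.ne_zero_of_lt hjk)
      rcases i with _ | i
      · exact h1 j k _ (by simpa using hk) (by omega)
      · exact h2 i j k (by omega) (by omega) (by simpa using hk)
    · intro h
      exact ⟨fun j k _ hk hjk => h 0 (j + 1) (k + 1) (by omega) (by omega) (by simpa using hk),
        fun i j k hij hjk hk =>
          h (i + 1) (j + 1) (k + 1) (by omega) (by omega) (by simpa using hk)⟩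

theorem isInversionFrom_iff_getElem {l : List ℕ} {k : ℕ} :
    IsInversionFrom k l ↔ ∀ (i : ℕ) (hi : i < l.length), l[i] ≤ i + k := by
  induction l generalizing k with
  | nil => simp [IsInversionFrom]
  | cons a l ih =>
    rw [IsInversionFrom, ih]
    constructor
    · rintro ⟨h1, h2⟩ i hi
      rcases i with _ | i
      · simpa using h1
      · simpa [add_assoc, add_comm, add_left_comm] using h2 i (by simpa using hi)
    · intro h
      refine ⟨(h 0 (Nat.succ_pos _)).trans_eq (zero_add k), fun i hi => ?_⟩
      exact (h (i + 1) (Nat.succ_lt_succ hi)).trans_eq (by ring)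

theorem avoids_102_iff {n : ℕ} (e : Fin n → ℕ) :
    Avoids e ![1, 0, 2] ↔ ListAvoids102 (List.ofFn e) := by
  rw [Avoids, Contains, exists_strictMono_fin_three_iff, listAvoids102_iff_getElem]
  simp only [reduction_eq_102_iff, List.getElem_ofFn, List.length_ofFn]
  push Not
  constructor
  · intro h i j k hij hjk hk hlt
    exact h ⟨i, by omega⟩ ⟨j, by omega⟩ ⟨k, hk⟩ hij hjk hlt
  · intro h i j k hij hjk hlt
    exact h i j k hij hjk k.2 hlt

theorem avoids_000_iff {n : ℕ} (e : Fin n → ℕ) :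
    Avoids e ![0, 0, 0] ↔ ∀ a, (List.ofFn e).count a ≤ 2 := by
  rw [Avoids, Contains, exists_strictMono_fin_three_iff, ← not_iff_not, not_not]
  simp only [reduction_eq_000_iff]
  push Not
  have h3 (a : ℕ) : 2 < (List.ofFn e).count a ↔ 3 ≤ (List.ofFn e).count a := Iff.rfl
  simp only [h3, ← List.replicate_sublist_iff, List.sublist_iff_exists_fin_orderEmbedding_get_eq]
  constructor
  · rintro ⟨i, j, k, hij, hjk, h1, h2⟩
    have hmono : StrictMono fun t : Fin 3 => Fin.cast (List.length_ofFn (f := e)).symm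
        (![i, j, k] t) := by
      rw [Fin.strictMono_iff_lt_succ]
      intro t
      fin_cases t
      exacts [hij, hjk]
    refine ⟨e i, OrderEmbedding.ofStrictMono _ hmono, fun t => ?_⟩
    change Fin 3 at t
    fin_cases t
    · simp
    · simpa using h1
    · simpa using h1.trans h2
  · rintro ⟨a, f, hf⟩
    change Fin 3 ↪o _ at f
    change ∀ t : Fin 3, _ at hf
    have hf' (t : Fin 3) : a = e ((f t).cast List.length_ofFn) := by
      rw [← List.get_ofFn e, ← hf t]
      fin_cases t <;> rfl
    refine ⟨(f 0).cast List.length_ofFn, (f 1).cast List.length_ofFn,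
      (f 2).cast List.length_ofFn, f.strictMono (show (0 : Fin 3) < 1 by decide),
      f.strictMono (show (1 : Fin 3) < 2 by decide), (hf' 0).symm.trans (hf' 1),
      (hf' 1).symm.trans (hf' 2)⟩

theorem isGood_ofFn_iff {n m : ℕ} (e : Fin n → ℕ) :
    e ∈ IS n m ↔ IsGood (List.ofFn e) ∧ (List.ofFn e).toFinset.card = m := by
  have hinv : e ∈ inversionSequences n ↔ IsInversionFrom 0 (List.ofFn e) := by
    rw [inversionSequences, Fintype.mem_piFinset, isInversionFrom_iff_getElem]
    simp only [Finset.mem_range, Nat.lt_succ_iff, List.getElem_ofFn, List.length_ofFn, add_zero]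
    exact ⟨fun h i hi => h ⟨i, hi⟩, fun h j => h j j.2⟩
  have hdist : dist e = (List.ofFn e).toFinset.card := by
    rw [dist]
    congr 1
    ext a
    simp [List.mem_ofFn]
  classical
  rw [IS, Finset.mem_filter, hinv, avoids_102_iff, avoids_000_iff, hdist, IsGood]
  tauto

theorem card_IS (n m : ℕ) : ((IS n m).card : ℚ) = coeffXY n m (stateSeries 1) := by
  rw [coeffXY_stateSeries_one]
  congr 1
  refine Finset.card_bij (fun e _ => List.ofFn e) ?_ (fun e _ e' _ h => List.ofFn_injective h) ?_
  · intro e he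
    rw [isGood_ofFn_iff] at he
    rw [Finset.mem_filter, mem_goodWords_iff]
    refine ⟨⟨he.1, fun a ha => ?_⟩, List.length_ofFn, he.2⟩
    obtain ⟨i, hi, rfl⟩ := List.mem_iff_getElem.1 ha
    have := isInversionFrom_iff_getElem.1 he.1.2.2 i hi
    rw [List.length_ofFn] at hi
    omega
  · intro w hw
    rw [Finset.mem_filter, mem_goodWords_iff] at hw
    obtain ⟨⟨hw, -⟩, rfl, hm⟩ := hw
    exact ⟨w.get, by rw [isGood_ofFn_iff, List.ofFn_get]; exact ⟨hw, hm⟩, List.ofFn_get w⟩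

/-! ### Comparison of coefficients -/

theorem coeffXY_mul (n m : ℕ) (f g : ℚ⟦X⟧⟦X⟧) :
    coeffXY n m (f * g) = ∑ k ∈ Finset.range (n + 1), ∑ l ∈ Finset.range (m + 1),
      coeffXY k l f * coeffXY (n - k) (m - l) g := by
  rw [coeffXY, PowerSeries.coeff_mul, map_sum,
    Finset.Nat.sum_antidiagonal_eq_sum_range_succ_mk, Finset.sum_comm]
  refine Finset.sum_congr rfl fun l _ => ?_
  rw [PowerSeries.coeff_mul, Finset.Nat.sum_antidiagonal_eq_sum_range_succ_mk]
  rfl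

theorem coeffXY_add (n m : ℕ) (f g : ℚ⟦X⟧⟦X⟧) :
    coeffXY n m (f + g) = coeffXY n m f + coeffXY n m g := by
  simp [coeffXY]

theorem coeffXY_one (n m : ℕ) : coeffXY n m 1 = if n = 0 ∧ m = 0 then 1 else 0 := by
  rw [coeffXY, PowerSeries.coeff_one]
  by_cases hm : m = 0
  · simp [hm, PowerSeries.coeff_one]
  · simp [hm]

theorem coeffXY_x_mul (n m : ℕ) (f : ℚ⟦X⟧⟦X⟧) : coeffXY (n + 1) m (x * f) = coeffXY n m f := by
  simp [coeffXY, x, PowerSeries.coeff_succ_X_mul]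

theorem b_zero_left (m : ℕ) : b 0 m = if m = 0 then 1 else 0 := by
  rw [b]
  split_ifs <;> first | rfl | omega

theorem card_IS_eq {n m : ℕ} (hn : 1 ≤ n) :
    ((IS n m).card : ℚ) = b (n + 1) m +
      ∑ k ∈ Finset.Icc 1 n, ∑ l ∈ Finset.range (m + 1), b k l * b (n - k) (m - l) := by
  obtain ⟨B, hB⟩ := exists_functionalEquation
  have hb := coeffXY_of_functionalEquation hB
  -- Keeping `x * B` on the left makes its coefficient `b n m` cancel the term `k = 0` of the
  -- convolution for `B * B`.
  have h : x * (stateSeries 1 + B) = B + x * (1 + B * B) + (-1 : ℚ⟦X⟧⟦X⟧) := by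
    linear_combination x_mul_stateSeries_one hB
  have hc := congrArg (coeffXY (n + 1) m) h
  have hneg : coeffXY (n + 1) m (-1) = 0 := by
    have := coeffXY_one (n + 1) m
    simp [coeffXY] at this ⊢
    exact this
  rw [coeffXY_x_mul, coeffXY_add, coeffXY_add, coeffXY_add, coeffXY_x_mul, coeffXY_add,
    coeffXY_mul, hneg, coeffXY_one, if_neg (by omega), ← card_IS, Finset.range_eq_Ico,
    Finset.sum_eq_sum_Ico_succ_bot (Nat.succ_pos n)] at hc
  simp only [hb, zero_add, add_zero, Nat.sub_zero] at hc
  have h0 : ∑ l ∈ Finset.range (m + 1), b 0 l * b n (m - l) = b n m := by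
    rw [Finset.sum_eq_single_of_mem 0 (by simp)]
    · simp [b_zero_left]
    · intro l _ hl
      simp [b_zero_left, hl]
  rw [h0, Nat.succ_eq_add_one, Finset.Ico_add_one_right_eq_Icc] at hc
  linear_combination hc

end InvSeq

theorem mainTheorem2 :
    (∃! B : PowerSeries (PowerSeries ℚ), InvSeq.FunctionalEquation B) ∧
    (∀ B : PowerSeries (PowerSeries ℚ), InvSeq.FunctionalEquation B →
      ∀ n m : ℕ, InvSeq.coeffXY n m B = InvSeq.b n m) ∧
    (∀ n m : ℕ, 1 ≤ n → 1 ≤ m →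
      ((InvSeq.IS n m).card : ℚ) =
        InvSeq.b (n + 1) m +
          ∑ k ∈ Finset.Icc 1 n, ∑ l ∈ Finset.range (m + 1),
            InvSeq.b k l * InvSeq.b (n - k) (m - l)) :=
  ⟨InvSeq.existsUnique_functionalEquation,
    fun _ hB => InvSeq.coeffXY_of_functionalEquation hB,
    fun _ _ hn _ => InvSeq.card_IS_eq hn⟩
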